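/- For a matrix $M$ over a commutative ring, with rows indexed by a finite set $\mathcal R$ and columns by a finite set $\mathcal C$, let $$R(x;M)=\sum_{S\subseteq \mathcal R}x^{|S|}\sum_{\sigma:S\hookrightarrow \mathcal C}\ \prod_{i\in S}M_{i,\sigma(i)}$$ be its rook polynomial ($\sigma$ runs over injections, and $S=\emptyset$ contributes $1$). Let $T_N^{(s)}$ be the $N\times N$ matrix whose $(i,j)$ entry is $1$ if $j-i=s$ and $0$ otherwise, let $J_k$ be the $k\times k$ matrix of ones, and let $N_{m}=\{1,\dots,m\}$. Write $i^{\langle l\rangle}$ for $i,i,\dots,i$ ($l$ times), and let $$G_t^{[k]}=\{(1^{\langle l_1\rangle},\dots,t^{\langle l_t\rangle})\mid 0\le l_i\le k,\ 1\le i\le t\}.$$ For $\alpha\in G_t^{[k]}$ let $m_\alpha(i)$ be the number of components of $\alpha$ equal to $i$, and let $\{\alpha\}$ be the multiset of its components. For integers $c,d$ let $c+d\alpha$ be obtained by replacing each component $y$ of $\alpha$ by $c+dy$. For elements $b_0,\dots,b_t$ of a commutative ring define a matrix $K_t^{[k]}(b_0,\dots,b_t)$ with rows and columns indexed by $G_t^{[k]}$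 as follows. For $t=0$ its only entry is $\sum_{d=0}^k d!\binom kd^2b_0^d$. For $t\ge1$ and $\alpha=(1^{\langle l_1\rangle},\dots,t^{\langle l_t\rangle})$, its $(\alpha,\beta)$ entry is $$\binom{l_1}{p_1}\cdots\binom{l_{t-1}}{p_{t-1}}\binom{k}{v-\sum_{i=1}^{t-1} p_i}\,b_0^{\,v-\sum_{i=1}^{t-1} p_i}\,b_1^{p_1}\cdots b_{t-1}^{p_{t-1}}\sum_{d=0}^{\min(l_t,k-v)}(d+v)!\binom{k}{d+v}\binom{l_t}{d}b_t^{d}$$ if $\beta=\bigl(1^{\langle k-v+\sum_{i=1}^{t-1} p_i\rangle},2^{\langle l_1-p_1\rangle},\dots,t^{\langle l_{t-1}-p_{t-1}\rangle}\bigr)$ for some (necessarily unique) integers with $0\le p_i\le l_i$ $(1\le i\le t-1)$ and $\sum_{i=1}^{t-1}p_i\le v\le k$, and it is $0$ otherwise. **Theorem.** Let $t\ge0$, $n\ge1$, $k\ge1$, $m=\min(n,t)$, and let $a_0,\dots,a_t$ be elements of a commutative ring with unity. Then for all $\beta\in G_m^{[k]}$ and $\alpha\in G_t^{[k]}$, the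 rook polynomial of the matrix $$M=\Bigl(\Bigl(\sum_{i=0}^t a_iT_{n+t}^{(i)}\Bigr)\otimes J_k\Bigr)\bigl[N_{nk}\,\big|\,k(1^{\langle k-m_\beta(1)\rangle},\dots,m^{\langle k-m_\beta(m)\rangle}),\,mk+1,\dots,nk,\,nk+k\alpha\bigr]$$ (the rows are $1,\dots,nk$; a column listed several times is repeated) is $$R(x;M)=\Bigl(\prod_{i=1}^{m}\binom{k}{m_\beta(i)}^{-1}\Bigr)\sum_{\substack{\gamma\in G_t^{[k]}\\ \{\gamma\}\supseteq\{\beta\}}}\ \prod_{i=1}^{m}\binom{m_\gamma(i)}{m_\beta(i)}\cdot\bigl(K_t^{[k]}(a_0x,\dots,a_tx)\bigr)^n_{\alpha,\gamma}.$$ The division by the binomial coefficients is understood as carried out for independent variables $a_0,\dots,a_t$: the right-hand side, formed in $\mathbb Q[a_0,\dots,a_t][x]$, lies in $\mathbb Z[a_0,\dots,a_t][x]$, and in an arbitrary commutative ring its value is obtained by substituting the given elements for the variables. In particular, $\prod_{i=1}^m\binom{k}{m_\beta(i)}\cdot R(x;M)$ equals the sum on the right computed in the given ring. -/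

import Mathlib

open scoped Kronecker

namespace RookToeplitz

noncomputable section

/-- The rook polynomial `R(x; M) = ∑_S x^{|S|} ∑_σ ∏_{i ∈ S} M i (σ i)`, where `S` runs over all
sets of rows and `σ` over the injections of `S` into the set of columns
(the empty `S` contributes the constant term `1`). -/
def rookPolynomial {A R C : Type*} [CommRing A] [Fintype R] [DecidableEq R]
    [Fintype C] [DecidableEq C] (M : Matrix R C A) : Polynomial A :=
  ∑ S : Finset R, Polynomial.X ^ S.card *
    ∑ σ : (S ↪ C), Polynomial.C (∏ i : S, M i (σ i))

/-- The `N × N` matrix `T_N^{(s)}`: the entry `(i, j)` is `1` if `j - i = s`, and `0` otherwise. -/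
def toeplitzUnit (A : Type*) [CommRing A] (N : ℕ) (s : ℤ) : Matrix (Fin N) (Fin N) A :=
  Matrix.of fun i j => if ((j : ℕ) : ℤ) - ((i : ℕ) : ℤ) = s then 1 else 0

/-- `J_k`, the `k × k` matrix of ones. -/
def allOnes (A : Type*) [CommRing A] (k : ℕ) : Matrix (Fin k) (Fin k) A :=
  Matrix.of fun _ _ => 1

/-- `(∑_{i=0}^t a_i T_N^{(i)}) ⊗ J_k`.  The index `(i, j)` of a row or column (both components
counted from `0`) is the row or column with number `i * k + j + 1`. -/
def bandKronecker {A : Type*} [CommRing A] (N k t : ℕ) (a : Fin (t + 1) → A) :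
    Matrix (Fin N × Fin k) (Fin N × Fin k) A :=
  (∑ i : Fin (t + 1), a i • toeplitzUnit A N ((i : ℕ) : ℤ)) ⊗ₖ allOnes A k

/-- The set `G_t^{[k]}` of vectors `(1^{⟨l_1⟩}, …, t^{⟨l_t⟩})` with `0 ≤ l_i ≤ k`.  Such a vector
`α` is given by its multiplicities: `m_α(i + 1) = l_{i+1}` is the value at `i : Fin t`. -/
abbrev G (k t : ℕ) : Type := Fin t → Fin (k + 1)

/-- The matrix `K_t^{[k]}(a_0, …, a_t)`, with rows and columns indexed by `G k t`.
For size `t + 1 ≥ 1` the row `α = (1^{⟨l_1⟩}, …, (t+1)^{⟨l_{t+1}⟩})` has a possibly nonzero entry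
in the column `β = (1^{⟨k - v + ∑ p_i⟩}, 2^{⟨l_1 - p_1⟩}, …, (t+1)^{⟨l_t - p_t⟩})`,
where `0 ≤ p_i ≤ l_i` and `∑ p_i ≤ v ≤ k`.  Here `p` and `v` are the only values
that can satisfy these conditions for the given `α` and `β`. -/
def Kmat {A : Type*} [CommRing A] (k : ℕ) :
    (t : ℕ) → (Fin (t + 1) → A) → Matrix (G k t) (G k t) A
  | 0, a => Matrix.of fun _ _ =>
      ∑ d ∈ Finset.range (k + 1), ((d.factorial * k.choose d ^ 2 : ℕ) : A) * a 0 ^ d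
  | t + 1, a => Matrix.of fun α β =>
      let l : Fin t → ℕ := fun i => (α i.castSucc : ℕ)
      let lt : ℕ := (α (Fin.last t) : ℕ)
      let p : Fin t → ℕ := fun i => l i - (β i.succ : ℕ)
      let v : ℕ := k + ∑ i, p i - (β 0 : ℕ)
      if (β 0 : ℕ) = k - v + ∑ i, p i ∧ (∀ i, (β i.succ : ℕ) = l i - p i) ∧
          ∑ i, p i ≤ v ∧ v ≤ k then
        (∏ i, ((l i).choose (p i) : A)) * (k.choose (v - ∑ i, p i) : A) *
          (a 0 ^ (v - ∑ i, p i) * ∏ i : Fin t, a i.castSucc.succ ^ p i) *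
          ∑ d ∈ Finset.range (min lt (k - v) + 1),
            (((d + v).factorial * k.choose (d + v) * lt.choose d : ℕ) : A) *
              a (Fin.last (t + 1)) ^ d
      else 0

/-- `K_t^{[k]}(a_0 x, …, a_t x)`, over the polynomial ring in `x`. -/
def KmatX {A : Type*} [CommRing A] (k t : ℕ) (a : Fin (t + 1) → A) :
    Matrix (G k t) (G k t) (Polynomial A) :=
  Kmat k t fun i => Polynomial.C (a i) * Polynomial.X

/-- The rows `1, 2, …, nk` of a matrix of order `(n + t) k`. -/
def rowSel (n k t : ℕ) : Fin n × Fin k → Fin (n + t) × Fin k :=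
  fun r => (Fin.castAdd t r.1, r.2)

/-- Positions in the list of columns, where `m = min(n, t)`: first
`k(1^{⟨k - m_β(1)⟩}, …, m^{⟨k - m_β(m)⟩})`, then `mk + 1, …, nk`, then `nk + kα`. -/
abbrev ColPos (n k t : ℕ) (β : G k (min n t)) (α : G k t) : Type :=
  (Σ i : Fin (min n t), Fin (k - (β i : ℕ))) ⊕
    ((Fin (n - min n t) × Fin k) ⊕ (Σ i : Fin t, Fin (α i : ℕ)))

/-- The column (of a matrix of order `(n + t) k`) found at each position of the list: the column
number `k * i` is the last one of the `i`-th block of `k` columns, and a column that is listed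
several times is repeated. -/
def colSel (n k t : ℕ) (β : G k (min n t)) (α : G k t) :
    ColPos n k t β α → Fin (n + t) × Fin k
  | .inl c => (⟨(c.1 : ℕ), by have := c.1.2; omega⟩, ⟨k - 1, by have := c.2.2; omega⟩)
  | .inr (.inl c) => (⟨min n t + (c.1 : ℕ), by have := c.1.2; omega⟩, c.2)
  | .inr (.inr c) => (Fin.natAdd n c.1,
      ⟨k - 1, by have h1 := c.2.2; have h2 := (α c.1).2; omega⟩)

/-- The submatrix
`((∑ a_i T_{n+t}^{(i)}) ⊗ J_k)[N_{nk} | k(1^{⟨k - m_β(1)⟩}, …), mk + 1, …, nk, nk + kα]`. -/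
def bandSubmatrix {A : Type*} [CommRing A] (n k t : ℕ) (a : Fin (t + 1) → A)
    (β : G k (min n t)) (α : G k t) : Matrix (Fin n × Fin k) (ColPos n k t β α) A :=
  (bandKronecker (n + t) k t a).submatrix (rowSel n k t) (colSel n k t β α)

/-- `{γ} ⊇ {β}` as multisets, for `γ ∈ G_t^{[k]}` and `β ∈ G_{min(n,t)}^{[k]}`. -/
def Contains {n k t : ℕ} (γ : G k t) (β : G k (min n t)) : Prop :=
  ∀ i : Fin (min n t), β i ≤ γ (Fin.castLE (min_le_right n t) i)

open Classical in
/-- `∑_{γ ∈ G_t^{[k]}, {γ} ⊇ {β}} ∏_{i=1}^{min(n,t)} C(m_γ(i), m_β(i)) ·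
(K_t^{[k]}(a_0 x, …, a_t x))^n [α | γ]`. -/
def weightedSum {A : Type*} [CommRing A] (n k t : ℕ) (a : Fin (t + 1) → A)
    (β : G k (min n t)) (α : G k t) : Polynomial A :=
  ∑ γ : G k t with Contains γ β,
    (∏ i : Fin (min n t),
      ((γ (Fin.castLE (min_le_right n t) i) : ℕ).choose (β i : ℕ) : Polynomial A)) *
      (KmatX k t a ^ n) α γ

end

end RookToeplitz

namespace RookToeplitz

open Finset

/-! An entry of the matrix depends on its column only through the column's block of `k`, its class.
Expand the product over the rows of `1 + ∑ y_i z_{r+i}`, with `y_i = a_i x` and one variable `z_j`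
per class: a monomial `z^p` records how many columns of each class are used, and the injections
realising it number the product of the falling factorials of the class sizes. So the rook polynomial
is the value of a linear functional on this product (`sum_embedding_eq_fallingEval`).

The functional may also weight each monomial by a function `g` of the unused columns. Removing the
last block of `k` equal rows is then a transfer step (`fallingEval_pow_mul`): the state is the sizes
of the `t` classes after a full one, and its transition matrix is `Kmat`. Iteration gives `Kmat ^ n`
(`fallingEval_band`), which needs full classes.

The columns deleted according to `β` are handled by the weight `g = ∏ C(c_j, b_j)`: deleting `b_j`
columns and then placing rooks amounts to placing rooks and then marking `b_j` unused columns
(`fallingEval_prod_choose`). This produces the binomial factors on both sides. The quotient is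
integral because it is the rook polynomial with indeterminate entries. -/

theorem descFactorial_add (n a b : ℕ) :
    n.descFactorial (a + b) = n.descFactorial a * (n - a).descFactorial b := by
  rw [← Nat.descFactorial_mul_descFactorial (Nat.le_add_right a b), Nat.add_sub_cancel_left,
    mul_comm]

/-- Both sides count a list of `p` distinct elements together with a disjoint `b`-subset, in either
order of choice. -/
theorem descFactorial_mul_choose_sub (c p b : ℕ) :
    c.descFactorial p * (c - p).choose b = c.choose b * (c - b).descFactorial p := by
  apply Nat.eq_of_mul_eq_mul_left b.factorial_pos
  calc b.factorial * (c.descFactorial p * (c - p).choose b)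
      = c.descFactorial p * (c - p).descFactorial b := by
        rw [Nat.descFactorial_eq_factorial_mul_choose (c - p) b]; ring
    _ = c.descFactorial b * (c - b).descFactorial p := by
        rw [← descFactorial_add, ← descFactorial_add, add_comm]
    _ = _ := by rw [Nat.descFactorial_eq_factorial_mul_choose c b]; ring

/-- The product of the falling factorials `c_j (c_j - 1) ⋯ (c_j - p_j + 1)`: the number of ways to
choose, for each `j`, a list of `p_j` distinct elements of a set of `c_j` elements. -/
def fallingProd (c : ℕ → ℕ) (p : ℕ →₀ ℕ) : ℕ :=
  p.prod fun j e => (c j).descFactorial e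

theorem fallingProd_of_subset (c : ℕ → ℕ) (p : ℕ →₀ ℕ) {s : Finset ℕ} (hs : p.support ⊆ s) :
    fallingProd c p = ∏ j ∈ s, (c j).descFactorial (p j) :=
  p.prod_of_support_subset hs _ fun _ _ => Nat.descFactorial_zero _

theorem fallingProd_add (c : ℕ → ℕ) (p q : ℕ →₀ ℕ) :
    fallingProd c (p + q) = fallingProd c p * fallingProd (c - ⇑p) q := by
  classical
  rw [fallingProd_of_subset c (p + q) Finsupp.support_add,
    fallingProd_of_subset c p subset_union_left, fallingProd_of_subset _ q subset_union_right,
    ← prod_mul_distrib]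
  exact prod_congr rfl fun j _ => descFactorial_add _ _ _

/-! ### The falling-factorial functional. -/

section FallingEval

variable {B : Type*} [CommRing B]

/-- The linear functional on polynomials in the variables `z_j` that sends `z^p` to
`∏_j c_j (c_j - 1) ⋯ (c_j - p_j + 1) · g(c - p)`. -/
noncomputable def fallingEval (g : (ℕ → ℕ) → B) (c : ℕ → ℕ) : MvPolynomial ℕ B →ₗ[B] B :=
  (MvPolynomial.basisMonomials ℕ B).constr B fun p => (fallingProd c p : B) * g (c - ⇑p)

theorem fallingEval_monomial (g : (ℕ → ℕ) → B) (c : ℕ → ℕ) (p : ℕ →₀ ℕ) (b : B) :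
    fallingEval g c (MvPolynomial.monomial p b) = b * ((fallingProd c p : B) * g (c - ⇑p)) := by
  have h : (MvPolynomial.monomial p b : MvPolynomial ℕ B) =
      b • MvPolynomial.basisMonomials ℕ B p := by
    rw [MvPolynomial.coe_basisMonomials, MvPolynomial.smul_monomial, smul_eq_mul, mul_one]
  rw [h, map_smul, fallingEval, Module.Basis.constr_basis, smul_eq_mul]

theorem fallingEval_one (g : (ℕ → ℕ) → B) (c : ℕ → ℕ) : fallingEval g c 1 = g c := by
  rw [← MvPolynomial.C_1, MvPolynomial.C_apply, fallingEval_monomial]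
  simp [fallingProd]

/-- Columns may be used up in two stages, the second working with what the first leaves; this makes
recursion on the rows possible. -/
theorem fallingEval_monomial_mul (g : (ℕ → ℕ) → B) (c : ℕ → ℕ) (p : ℕ →₀ ℕ) (b : B)
    (q : MvPolynomial ℕ B) :
    fallingEval g c (MvPolynomial.monomial p b * q) =
      b * (fallingProd c p : B) * fallingEval g (c - ⇑p) q := by
  induction q using MvPolynomial.induction_on' with
  | monomial u a =>
    rw [MvPolynomial.monomial_mul, fallingEval_monomial, fallingEval_monomial, fallingProd_add,
      Finsupp.coe_add, tsub_add_eq_tsub_tsub]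
    push_cast
    ring
  | add q r hq hr => rw [mul_add, map_add, map_add, hq, hr, mul_add]

/-- Requiring `b_j` chosen elements of each class to remain unused. -/
theorem fallingEval_prod_choose (s : Finset ℕ) (b : ℕ → ℕ) (hb : ∀ j ∉ s, b j = 0) (c : ℕ → ℕ)
    (q : MvPolynomial ℕ B) :
    fallingEval (fun c => ((∏ j ∈ s, (c j).choose (b j) : ℕ) : B)) c q =
      ((∏ j ∈ s, (c j).choose (b j) : ℕ) : B) * fallingEval (fun _ => 1) (c - b) q := by
  classical
  -- Outside `s` the factors are `C(c_j, 0) = 1`, so both products can run over one index set.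
  have key (c : ℕ → ℕ) (u : Finset ℕ) :
      ∏ j ∈ s, (c j).choose (b j) = ∏ j ∈ s ∪ u, (c j).choose (b j) :=
    prod_subset subset_union_left fun j _ hj => by rw [hb j hj, Nat.choose_zero_right]
  induction q using MvPolynomial.induction_on' with
  | monomial u a =>
    rw [fallingEval_monomial, fallingEval_monomial, mul_one, ← Nat.cast_mul,
      mul_left_comm, ← Nat.cast_mul, key _ u.support, key _ u.support,
      fallingProd_of_subset c u (subset_union_right (s₁ := s)),
      fallingProd_of_subset _ u (subset_union_right (s₁ := s)), ← prod_mul_distrib,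
      ← prod_mul_distrib]
    congr 2
    exact prod_congr rfl fun j _ => descFactorial_mul_choose_sub _ _ _
  | add q r hq hr => rw [map_add, map_add, hq, hr, mul_add]

end FallingEval

/-! ### From partial injections to the functional. -/

/-- The injections that refine a given map `τ` to the classes of a set: they amount to one
injection for each class. -/
def embeddingOverEquiv {S C J : Type*} [DecidableEq J] (τ : S → J) (f : C → J) (u : Finset J)
    (hu : ∀ s, τ s ∈ u) :
    {σ : S ↪ C // ∀ s, f (σ s) = τ s} ≃ ∀ j : u, {s // τ s = j} ↪ {c // f c = j} where
  toFun σ j := ⟨fun s => ⟨σ.1 s, (σ.2 s).trans s.2⟩, fun s s' h =>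
    Subtype.ext (σ.1.injective (congrArg Subtype.val h))⟩
  invFun e := ⟨⟨fun s => (e ⟨τ s, hu s⟩ ⟨s, rfl⟩).1, fun s s' h => by
    have h1 := (e ⟨τ s, hu s⟩ ⟨s, rfl⟩).2
    have h2 := (e ⟨τ s', hu s'⟩ ⟨s', rfl⟩).2
    have h3 : τ s' = τ s := h2.symm.trans ((congrArg f h.symm).trans h1)
    -- The two values come from embeddings of fibres with different indices; transport along `τ s' =
    -- τ s` puts them in one fibre, where injectivity applies.
    have h4 (j : u) (hj : τ s' = j) : (e j ⟨s', hj⟩).1 = (e ⟨τ s', hu s'⟩ ⟨s', rfl⟩).1 := by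
      obtain rfl : j = ⟨τ s', hu s'⟩ := Subtype.ext hj.symm
      rfl
    have h5 := (e ⟨τ s, hu s⟩).injective (Subtype.ext (h.trans (h4 ⟨τ s, hu s⟩ h3).symm))
    exact congrArg Subtype.val h5⟩, fun s => (e ⟨τ s, hu s⟩ ⟨s, rfl⟩).2⟩
  left_inv σ := by ext; rfl
  right_inv e := by
    ext j ⟨s, hs⟩
    obtain rfl : j = ⟨τ s, hu s⟩ := Subtype.ext hs.symm
    rfl

theorem card_embedding_over {S C : Type*} [Fintype S] [Fintype C] [DecidableEq S] [DecidableEq C]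
    (τ : S → ℕ) (f : C → ℕ) :
    #{σ : S ↪ C | ∀ s, f (σ s) = τ s} =
      fallingProd (fun j => #{c | f c = j}) (∑ s, Finsupp.single (τ s) 1) := by
  have hp (j : ℕ) : (∑ s, Finsupp.single (τ s) 1 : ℕ →₀ ℕ) j = #{s | τ s = j} := by
    rw [Finsupp.finsetSum_apply, card_filter]
    exact sum_congr rfl fun s _ => Finsupp.single_apply
  have hs : (∑ s, Finsupp.single (τ s) 1 : ℕ →₀ ℕ).support ⊆ univ.image τ := fun j hj => by
    rw [Finsupp.mem_support_iff, hp, Finset.card_ne_zero] at hj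
    obtain ⟨s, hs⟩ := hj
    exact mem_image.2 ⟨s, mem_univ _, (mem_filter.1 hs).2⟩
  rw [fallingProd_of_subset _ _ hs, ← Fintype.card_subtype,
    Fintype.card_congr (embeddingOverEquiv τ f (univ.image τ)
      fun s => mem_image_of_mem τ (mem_univ s)), Fintype.card_pi,
    ← prod_coe_sort (univ.image τ)]
  refine prod_congr rfl fun j _ => ?_
  rw [Fintype.card_embedding_eq, Fintype.card_subtype, Fintype.card_subtype, hp]

/-- A sum over partial injections of products of weights that depend only on the classes of the
columns is a value of `fallingEval`. -/
theorem sum_embedding_eq_fallingEval {B R C I : Type*} [CommRing B] [Fintype R] [DecidableEq R]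
    [Fintype C] [DecidableEq C] [Fintype I] [DecidableEq I] (y : I → B) (h : R → I → ℕ)
    (f : C → ℕ) :
    ∑ S : Finset R, ∑ σ : S ↪ C, ∏ r : S, ∑ i, (if f (σ r) = h r i then y i else 0) =
      fallingEval (fun _ => 1) (fun j => #{c | f c = j})
        (∏ r : R, (1 + ∑ i, MvPolynomial.C (y i) * MvPolynomial.X (h r i))) := by
  rw [prod_one_add, powerset_univ, map_sum]
  refine sum_congr rfl fun S _ => ?_
  rw [← prod_coe_sort S, prod_univ_sum, map_sum]
  simp_rw [prod_univ_sum]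
  -- For a fixed choice `ε` of a summand in each row, the surviving `σ` are exactly those lying over
  -- the classes `h r (ε r)`.
  rw [sum_comm]
  refine sum_congr rfl fun ε _ => ?_
  have h1 : (∏ r : S, MvPolynomial.C (y (ε r)) * MvPolynomial.X (h r (ε r)) : MvPolynomial ℕ B) =
      MvPolynomial.monomial (∑ r : S, Finsupp.single (h r (ε r)) 1) (∏ r, y (ε r)) := by
    rw [MvPolynomial.monomial_sum_index, prod_mul_distrib, map_prod]
    rfl
  rw [h1, fallingEval_monomial, ← card_embedding_over, mul_one, card_filter, Nat.cast_sum, mul_sum]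
  refine sum_congr rfl fun σ _ => ?_
  rw [prod_ite_zero]
  simp

theorem sum_range_sum_piAntidiag {I B : Type*} [Fintype I] [DecidableEq I] [AddCommMonoid B]
    (k : ℕ) (F : (I → ℕ) → B) (hF : ∀ p, k < ∑ i, p i → F p = 0) :
    ∑ d ∈ range (k + 1), ∑ p ∈ piAntidiag univ d, F p =
      ∑ p : I → Fin (k + 1), F fun i => (p i : ℕ) := by
  have h1 : ∑ p : I → Fin (k + 1), F (fun i => (p i : ℕ)) =
      ∑ p : I → Fin (k + 1) with ∑ i, (p i : ℕ) ≤ k, F fun i => (p i : ℕ) :=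
    (sum_filter_of_ne fun p _ hp => not_lt.1 fun h => hp (hF _ h)).symm
  have hle {d : ℕ} {p : I → ℕ} (hd : d < k + 1) (hp : ∑ i, p i = d) (i : I) : p i < k + 1 :=
    (single_le_sum (fun _ _ => Nat.zero_le _) (mem_univ i)).trans_lt (hp.trans_lt hd)
  rw [h1, sum_sigma']
  refine sum_nbij' (fun x i => Fin.ofNat (k + 1) (x.2 i))
    (fun p => ⟨∑ i, (p i : ℕ), fun i => (p i : ℕ)⟩) ?_ ?_ ?_ ?_ ?_
  · rintro ⟨d, p⟩ h
    simp only [mem_sigma, mem_range, mem_piAntidiag, mem_filter, mem_univ, true_and] at h ⊢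
    simp only [Fin.val_ofNat, Nat.mod_eq_of_lt (hle h.1 h.2.1 _)]
    exact h.2.1.trans_le (Nat.lt_succ_iff.1 h.1)
  · intro p h
    simpa [Nat.lt_succ_iff] using h
  · rintro ⟨d, p⟩ h
    simp only [mem_sigma, mem_range, mem_piAntidiag] at h
    simp only [Fin.val_ofNat, Nat.mod_eq_of_lt (hle h.1 h.2.1 _), h.2.1]
  · intro p _
    ext i
    simp
  · rintro ⟨d, p⟩ h
    simp only [mem_sigma, mem_range, mem_piAntidiag] at h
    simp only [Fin.val_ofNat, Nat.mod_eq_of_lt (hle h.1 h.2.1 _)]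

/-- Expansion along a block of `k` equal rows: `p i` columns of the class `h i` are used. -/
theorem fallingEval_pow_mul {I B : Type*} [Fintype I] [DecidableEq I] [CommRing B]
    (g : (ℕ → ℕ) → B) (c : ℕ → ℕ) (k : ℕ) (y : I → B) (h : I → ℕ) (hinj : h.Injective)
    (q : MvPolynomial ℕ B) :
    fallingEval g c ((1 + ∑ i, MvPolynomial.C (y i) * MvPolynomial.X (h i)) ^ k * q) =
      ∑ p : I → Fin (k + 1),
        ((k.choose (∑ i, (p i : ℕ)) * (∑ i, (p i : ℕ)).factorial *
          ∏ i, (c (h i)).choose (p i) : ℕ) : B) * (∏ i, y i ^ (p i : ℕ)) *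
        fallingEval g (c - ⇑(∑ i, Finsupp.single (h i) (p i : ℕ))) q := by
  rw [← sum_range_sum_piAntidiag k (fun p : I → ℕ =>
    ((k.choose (∑ i, p i) * (∑ i, p i).factorial * ∏ i, (c (h i)).choose (p i) : ℕ) : B) *
      (∏ i, y i ^ p i) * fallingEval g (c - ⇑(∑ i, Finsupp.single (h i) (p i))) q)
    fun p hp => by simp [Nat.choose_eq_zero_of_lt hp]]
  rw [add_comm, add_pow, sum_mul, map_sum]
  refine sum_congr rfl fun d _ => ?_
  rw [sum_pow_eq_sum_piAntidiag, one_pow, mul_one, sum_mul, sum_mul, map_sum]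
  refine sum_congr rfl fun p hp => ?_
  have hsum : ∑ i, p i = d := (mem_piAntidiag.1 hp).1
  have hmon : (∏ i, (MvPolynomial.C (y i) * MvPolynomial.X (h i)) ^ p i : MvPolynomial ℕ B) =
      MvPolynomial.monomial (∑ i, Finsupp.single (h i) (p i)) (∏ i, y i ^ p i) := by
    rw [MvPolynomial.monomial_sum_index, map_prod, ← prod_mul_distrib]
    refine prod_congr rfl fun i _ => ?_
    rw [mul_pow, MvPolynomial.X_pow_eq_monomial, map_pow]
  have hfall : fallingProd c (∑ i, Finsupp.single (h i) (p i)) =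
      ∏ i, (c (h i)).descFactorial (p i) := by
    have hs : (∑ i, Finsupp.single (h i) (p i)).support ⊆ univ.image h := fun j hj => by
      by_contra hj'
      refine Finsupp.mem_support_iff.1 hj ?_
      rw [Finsupp.finsetSum_apply]
      refine sum_eq_zero fun i _ => Finsupp.single_eq_of_ne fun hij => hj' ?_
      exact hij ▸ mem_image_of_mem h (mem_univ i)
    rw [fallingProd_of_subset _ _ hs, prod_image fun i _ j _ hij => hinj hij]
    refine prod_congr rfl fun i _ => ?_
    rw [Finsupp.finsetSum_apply, sum_eq_single i
      (fun j _ hj => Finsupp.single_eq_of_ne fun hij => hj (hinj hij).symm) (by simp),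
      Finsupp.single_eq_same]
  -- The denominators `p_i!` of the multinomial coefficient cancel against the falling factorials,
  -- leaving binomials.
  have hcount : Nat.multinomial univ p * fallingProd c (∑ i, Finsupp.single (h i) (p i)) =
      d.factorial * ∏ i, (c (h i)).choose (p i) := by
    rw [hfall, ← hsum, ← Nat.multinomial_spec univ p]
    simp_rw [Nat.descFactorial_eq_factorial_mul_choose]
    rw [prod_mul_distrib]
    ring
  have hcast : (Nat.multinomial univ p : MvPolynomial ℕ B) *
      MvPolynomial.monomial (∑ i, Finsupp.single (h i) (p i)) (∏ i, y i ^ p i) *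
        (k.choose d : MvPolynomial ℕ B) * q =
      MvPolynomial.monomial (∑ i, Finsupp.single (h i) (p i))
        (((k.choose d * Nat.multinomial univ p : ℕ) : B) * ∏ i, y i ^ p i) * q := by
    rw [← MvPolynomial.C_mul_monomial, map_natCast]
    push_cast
    ring
  rw [hmon, hcast, fallingEval_monomial_mul, hsum, mul_assoc (k.choose d), ← hcount]
  push_cast
  ring

/-! ### The entries of `Kmat` as transition weights. -/

section Kmat

variable {B : Type*} [CommRing B] {k : ℕ}

theorem sum_peel_eq_Kmat_zero (y : Fin 1 → B) (α : G k 0) (Ψ : (Fin 1 → Fin (k + 1)) → B)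
    (Φ : G k 0 → B) (hΨ : ∀ p β, Ψ p = Φ β) :
    ∑ p : Fin 1 → Fin (k + 1),
      ((k.choose (∑ i, (p i : ℕ)) * (∑ i, (p i : ℕ)).factorial *
        ∏ i, k.choose (p i) : ℕ) : B) * (∏ i, y i ^ (p i : ℕ)) * Ψ p =
      ∑ β, Kmat k 0 y α β * Φ β := by
  rw [← (Equiv.funUnique (Fin 1) (Fin (k + 1))).symm.sum_comp,
    Fintype.sum_eq_single α fun β hβ => absurd (Subsingleton.elim β α) hβ]
  simp only [Kmat, Matrix.of_apply, sum_range, sum_mul]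
  refine sum_congr rfl fun d _ => ?_
  rw [hΨ _ α, Fin.sum_univ_one, Fin.prod_univ_one, Fin.prod_univ_one]
  simp only [Equiv.funUnique_symm_apply, uniqueElim_const]
  push_cast
  ring

/-- The multiplicities of the classes of columns, other than the last one, that the last block of
rows meets. -/
def cap {t : ℕ} (α : G k (t + 1)) : Fin (t + 1) → Fin (k + 1) :=
  Fin.cons (Fin.last k) fun i => α i.castSucc

/-- Here `p` counts the columns used in the classes other than the last, so the `v` of the
definition is `∑ p i`, and `d` counts those used in the last class. -/
theorem Kmat_succ_of_le {t : ℕ} (y : Fin (t + 2) → B) (α β : G k (t + 1))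
    (p : Fin (t + 1) → Fin (k + 1)) (hp : ∀ i, p i ≤ cap α i)
    (hβ : ∀ i, (β i : ℕ) = (cap α i : ℕ) - (p i : ℕ)) :
    Kmat k (t + 1) y α β = ((∏ i, (cap α i : ℕ).choose (p i) : ℕ) : B) *
      (∏ i, y i.castSucc ^ (p i : ℕ)) *
      ∑ d : Fin (k + 1), ((k.choose (∑ i, (p i : ℕ) + d) * (∑ i, (p i : ℕ) + d).factorial *
        (α (Fin.last t) : ℕ).choose d : ℕ) : B) * y (Fin.last (t + 1)) ^ (d : ℕ) := by
  have hp0 : (p 0 : ℕ) ≤ k := hp 0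
  have hβ0 : (β 0 : ℕ) = k - p 0 := hβ 0
  have hps (i : Fin t) : (p i.succ : ℕ) ≤ α i.castSucc := hp i.succ
  have hβs (i : Fin t) : (β i.succ : ℕ) = α i.castSucc - p i.succ := hβ i.succ
  have hpi (i : Fin t) : (α i.castSucc : ℕ) - (β i.succ : ℕ) = p i.succ := by
    rw [hβs, Nat.sub_sub_self (hps i)]
  have hv : k + ∑ i : Fin t, (p i.succ : ℕ) - (β 0 : ℕ) = ∑ i, (p i : ℕ) := by
    rw [Fin.sum_univ_succ, hβ0]
    omega
  have hv0 : ∑ i, (p i : ℕ) - ∑ i : Fin t, (p i.succ : ℕ) = p 0 := by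
    rw [Fin.sum_univ_succ, Nat.add_sub_cancel]
  have hsum : ∑ i, (p i : ℕ) = p 0 + ∑ i : Fin t, (p i.succ : ℕ) := Fin.sum_univ_succ _
  simp only [Kmat, Matrix.of_apply, hpi, hv, hv0]
  by_cases hk : ∑ i, (p i : ℕ) ≤ k
  · rw [if_pos ⟨by omega, hβs, by omega, hk⟩, Fin.prod_univ_succ, Fin.prod_univ_succ,
      ← sum_range fun d => ((k.choose (∑ i, (p i : ℕ) + d) * (∑ i, (p i : ℕ) + d).factorial *
        (α (Fin.last t) : ℕ).choose d : ℕ) : B) * y (Fin.last (t + 1)) ^ d]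
    congr 1
    · simp only [cap, Fin.cons_zero, Fin.cons_succ, Fin.val_last, Fin.castSucc_zero,
        Fin.succ_castSucc]
      push_cast
      ring
    -- The terms added beyond the `min` vanish, through one binomial coefficient or the other.
    · rw [← sum_subset (range_mono (show min (α (Fin.last t) : ℕ) (k - ∑ i, (p i : ℕ)) + 1 ≤ k + 1
        by omega))]
      · refine sum_congr rfl fun d _ => ?_
        rw [add_comm d, mul_comm (Nat.factorial _)]
      · intro d _ hd
        rw [mem_range, not_lt, Nat.succ_le_iff, min_lt_iff] at hd
        rcases hd with hd | hd
        · simp [Nat.choose_eq_zero_of_lt hd]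
        · simp [Nat.choose_eq_zero_of_lt (show k < ∑ i, (p i : ℕ) + d by omega)]
  · rw [if_neg fun h => hk h.2.2.2, sum_eq_zero, mul_zero]
    intro d _
    simp [Nat.choose_eq_zero_of_lt (show k < ∑ i, (p i : ℕ) + d by omega)]

theorem Kmat_succ_of_not_le {t : ℕ} (y : Fin (t + 2) → B) (α β : G k (t + 1))
    (h : ¬ ∀ i, β i ≤ cap α i) : Kmat k (t + 1) y α β = 0 := by
  simp only [Kmat, Matrix.of_apply]
  refine if_neg fun hc => h fun i => ?_
  refine Fin.cases (Fin.le_last _) (fun i => ?_) i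
  exact (hc.2.1 i).le.trans (Nat.sub_le _ _)

/-- The value `Ψ p` ignores the last component of `p`, so summing that component out gives a single
entry of `Kmat`. Used and unused columns correspond by the involution `p ↦ cap α - p`. -/
theorem sum_peel_eq_Kmat_succ {t : ℕ} (y : Fin (t + 2) → B) (α : G k (t + 1))
    (Ψ : (Fin (t + 2) → Fin (k + 1)) → B) (Φ : G k (t + 1) → B)
    (hΨ : ∀ p β, (∀ i : Fin (t + 1), (β i : ℕ) = (cap α i : ℕ) - p i.castSucc) → Ψ p = Φ β) :
    ∑ p : Fin (t + 2) → Fin (k + 1),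
      ((k.choose (∑ i, (p i : ℕ)) * (∑ i, (p i : ℕ)).factorial *
        ∏ i, (Fin.snoc (α := fun _ => ℕ) (fun i => (cap α i : ℕ)) (α (Fin.last t) : ℕ) i).choose
          (p i) : ℕ) : B) * (∏ i, y i ^ (p i : ℕ)) * Ψ p =
      ∑ β, Kmat k (t + 1) y α β * Φ β := by
  let co (p : Fin (t + 1) → Fin (k + 1)) : G k (t + 1) := fun i =>
    ⟨(cap α i : ℕ) - p i, (Nat.sub_le _ _).trans_lt (cap α i).2⟩
  have hco {p : Fin (t + 1) → Fin (k + 1)} (hp : ∀ i, p i ≤ cap α i) : co (co p) = p := by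
    ext i
    exact Nat.sub_sub_self (hp i)
  have hcole (p : Fin (t + 1) → Fin (k + 1)) (i) : co p i ≤ cap α i := Nat.sub_le _ _
  rw [← (Fin.snocEquiv fun _ : Fin (t + 2) => Fin (k + 1)).sum_comp, Fintype.sum_prod_type,
    sum_comm, ← sum_filter_of_ne (f := fun β => Kmat k (t + 1) y α β * Φ β)
      (p := fun β => ∀ i, β i ≤ cap α i)
      (fun β _ hβ => by_contra fun h => hβ (by rw [Kmat_succ_of_not_le y α β h, zero_mul])),
    ← sum_filter_of_ne (s := univ) (p := fun p : Fin (t + 1) → Fin (k + 1) => ∀ i, p i ≤ cap α i)]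
  · refine sum_nbij' co co (fun p _ => mem_filter.2 ⟨mem_univ _, hcole p⟩)
      (fun p _ => mem_filter.2 ⟨mem_univ _, hcole p⟩)
      (fun p hp => hco (mem_filter.1 hp).2) (fun p hp => hco (mem_filter.1 hp).2) fun p hp => ?_
    rw [Kmat_succ_of_le y α (co p) p (mem_filter.1 hp).2 fun i => rfl, mul_sum, sum_mul]
    refine sum_congr rfl fun d _ => ?_
    rw [hΨ _ (co p) fun i => by simp [co]]
    simp only [Fin.snocEquiv_apply, Fin.sum_univ_castSucc, Fin.prod_univ_castSucc,
      Fin.snoc_castSucc, Fin.snoc_last]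
    push_cast
    ring
  · intro p _ hp i
    by_contra hi
    refine hp (sum_eq_zero fun d _ => ?_)
    have : (cap α i : ℕ).choose (p i) = 0 := Nat.choose_eq_zero_of_lt (not_le.1 hi)
    have h0 : ∏ i, (cap α i : ℕ).choose (p i) = 0 := prod_eq_zero (mem_univ i) this
    simp [Fin.prod_univ_castSucc, h0]

end Kmat

/-! ### Iterating over the blocks of rows. -/

section Band

variable {B : Type*} [CommRing B] {k : ℕ}

theorem band_single_apply {t : ℕ} (r : ℕ) (p : Fin (t + 1) → ℕ) (i : Fin (t + 1)) :
    (∑ i : Fin (t + 1), Finsupp.single (r + (i : ℕ)) (p i) : ℕ →₀ ℕ) (r + (i : ℕ)) = p i := by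
  rw [Finsupp.finsetSum_apply, sum_eq_single i _ (by simp), Finsupp.single_eq_same]
  intro j _ hj
  refine Finsupp.single_eq_of_ne fun h => hj (Fin.ext ?_)
  omega

theorem band_single_apply_of_lt {t : ℕ} (r : ℕ) (p : Fin (t + 1) → ℕ) {j : ℕ} (hj : j < r) :
    (∑ i : Fin (t + 1), Finsupp.single (r + (i : ℕ)) (p i) : ℕ →₀ ℕ) j = 0 := by
  rw [Finsupp.finsetSum_apply]
  refine sum_eq_zero fun i _ => Finsupp.single_eq_of_ne ?_
  omega

/-- Each block of `k` rows of a band matrix contributes a factor `Kmat`. -/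
theorem fallingEval_band (t : ℕ) (y : Fin (t + 1) → B) (g : (ℕ → ℕ) → B) (g' : G k t → B)
    (hg : ∀ c γ, (∀ i : Fin t, c i = (γ i : ℕ)) → g c = g' γ) (r : ℕ) (α : G k t) (c : ℕ → ℕ)
    (hc : ∀ j < r, c j = k) (hα : ∀ i : Fin t, c (r + i) = (α i : ℕ)) :
    fallingEval g c (∏ r ∈ range r, (1 + ∑ i : Fin (t + 1),
        MvPolynomial.C (y i) * MvPolynomial.X (r + (i : ℕ))) ^ k) =
      ∑ γ, (Kmat k t y ^ r) α γ * g' γ := by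
  induction r generalizing α c with
  | zero =>
    rw [prod_range_zero, fallingEval_one, pow_zero, hg c α fun i => by rw [← hα, zero_add]]
    simp [Matrix.one_apply]
  | succ r ih =>
    rw [prod_range_succ, mul_comm, fallingEval_pow_mul g c k y (fun i => r + (i : ℕ))
      (fun i j h => Fin.ext (Nat.add_left_cancel h))]
    simp_rw [pow_succ', Matrix.mul_apply, sum_mul]
    rw [sum_comm]
    simp_rw [mul_assoc (Kmat k t y α _), ← mul_sum]
    -- The earlier rows do not meet class `r + t`, so only the remainders in classes `r, …, r + t -
    -- 1` form the new state.
    have hΨ (p : Fin (t + 1) → Fin (k + 1)) (β : G k t)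
        (hβ : ∀ i : Fin t, (β i : ℕ) = c (r + i) - p i.castSucc) :
        fallingEval g (c - ⇑(∑ i : Fin (t + 1), Finsupp.single (r + (i : ℕ)) (p i : ℕ)))
          (∏ r ∈ range r, (1 + ∑ i : Fin (t + 1),
            MvPolynomial.C (y i) * MvPolynomial.X (r + (i : ℕ))) ^ k) =
        ∑ γ, (Kmat k t y ^ r) β γ * g' γ := by
      refine ih β _ (fun j hj => ?_) fun i => ?_
      · rw [Pi.sub_apply, band_single_apply_of_lt r _ hj, hc j (hj.trans r.lt_succ_self),
          Nat.sub_zero]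
      · rw [Pi.sub_apply, hβ, ← Fin.val_castSucc i,
          band_single_apply r (fun i => (p i : ℕ)) i.castSucc]
    have hc0 : c r = k := hc r r.lt_succ_self
    cases t with
    | zero =>
      rw [← sum_peel_eq_Kmat_zero y α _ _ fun p β => hΨ p β fun i => i.elim0]
      refine sum_congr rfl fun p _ => ?_
      simp [hc0]
    | succ t =>
      have hcap (i : Fin (t + 1)) : c (r + i) = (cap α i : ℕ) := by
        refine Fin.cases ?_ (fun i => ?_) i
        · exact hc0
        · have := hα i.castSucc
          rw [Fin.val_castSucc, Nat.add_right_comm] at this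
          exact this
      rw [← sum_peel_eq_Kmat_succ y α _ _ fun p β h => hΨ p β fun i => by rw [h, hcap]]
      refine sum_congr rfl fun p _ => ?_
      have hprod : ∏ i : Fin (t + 2), (c (r + i)).choose (p i) =
          ∏ i, (Fin.snoc (α := fun _ => ℕ) (fun i => (cap α i : ℕ)) (α (Fin.last t) : ℕ) i).choose
            (p i) := by
        rw [Fin.prod_univ_castSucc, Fin.prod_univ_castSucc (n := t + 1), Fin.snoc_last]
        congr 1
        · refine prod_congr rfl fun i _ => ?_
          rw [Fin.snoc_castSucc, ← hcap, Fin.val_castSucc]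
        · have := hα (Fin.last t)
          rw [Fin.val_last, Nat.add_right_comm] at this
          rw [Fin.val_last, ← this, ← add_assoc]
      rw [hprod]

end Band

/-! ### Class sizes of the selected columns. -/

section Columns

variable {n k t : ℕ}

/-- The multiplicities of the classes of columns before any column of the first `min n t` classes
is removed. -/
def fullMult (n : ℕ) (α : G k t) (j : ℕ) : ℕ :=
  if j < n then k else if h : j - n < t then α ⟨j - n, h⟩ else 0

/-- The numbers of columns removed from the classes. -/
def removedMult (β : G k (min n t)) (j : ℕ) : ℕ :=
  if h : j < min n t then β ⟨j, h⟩ else 0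

theorem sum_ite_fin_eq (m : ℕ) (a : ℕ) (w : Fin m → ℕ) (j : ℕ) :
    ∑ i : Fin m, (if a + (i : ℕ) = j then w i else 0) =
      if h : a ≤ j ∧ j - a < m then w ⟨j - a, h.2⟩ else 0 := by
  split_ifs with h
  · rw [sum_eq_single ⟨j - a, h.2⟩ _ (by simp), if_pos (by simp; omega)]
    intro i _ hi
    exact if_neg fun hij => hi (Fin.ext (by simp; omega))
  · exact sum_eq_zero fun i _ => if_neg fun hij => h ⟨by omega, by omega⟩

theorem card_colSel_eq (β : G k (min n t)) (α : G k t) :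
    (fun j => #{c | ((colSel n k t β α c).1 : ℕ) = j}) =
      fullMult n α - removedMult β := by
  ext j
  have h1 := sum_ite_fin_eq (min n t) 0 (fun i => k - (β i : ℕ)) j
  have h2 := sum_ite_fin_eq (n - min n t) (min n t) (fun _ => k) j
  have h3 := sum_ite_fin_eq t n (fun i => (α i : ℕ)) j
  simp only [zero_add] at h1
  rw [card_filter, Fintype.sum_sum_type, Fintype.sum_sum_type, Fintype.sum_prod_type,
    Fintype.sum_sigma, Fintype.sum_sigma]
  change (∑ x : Fin (min n t), ∑ _ : Fin (k - (β x : ℕ)), if (x : ℕ) = j then 1 else 0) +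
    ((∑ x : Fin (n - min n t), ∑ _ : Fin k, if min n t + (x : ℕ) = j then 1 else 0) +
      ∑ x : Fin t, ∑ _ : Fin (α x : ℕ), if n + (x : ℕ) = j then 1 else 0) = _
  simp only [sum_const, card_univ, Fintype.card_fin, smul_eq_mul, mul_ite, mul_one, mul_zero]
  rw [h1, h2, h3]
  simp only [fullMult, removedMult, Pi.sub_apply, Nat.sub_zero]
  have := Nat.min_le_left n t
  split_ifs <;> omega

end Columns

/-! ### The rook polynomial of the band submatrix. -/

section Main

variable {A : Type*} [CommRing A] {n k t : ℕ}

theorem bandSubmatrix_apply (a : Fin (t + 1) → A) (β : G k (min n t)) (α : G k t)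
    (r : Fin n × Fin k) (c : ColPos n k t β α) :
    bandSubmatrix n k t a β α r c =
      ∑ i : Fin (t + 1), if ((colSel n k t β α c).1 : ℕ) = (r.1 : ℕ) + (i : ℕ) then a i else 0 := by
  simp only [bandSubmatrix, bandKronecker, Matrix.submatrix_apply, Matrix.kroneckerMap_apply,
    allOnes, Matrix.of_apply, mul_one, Matrix.sum_apply, Matrix.smul_apply, toeplitzUnit, rowSel,
    Fin.val_castAdd, smul_eq_mul, mul_ite, mul_zero]
  refine sum_congr rfl fun i _ => if_congr ?_ rfl rfl
  omega

theorem rookPolynomial_bandSubmatrix (a : Fin (t + 1) → A) (β : G k (min n t)) (α : G k t) :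
    rookPolynomial (bandSubmatrix n k t a β α) =
      fallingEval (fun _ => 1) (fullMult n α - removedMult β)
        (∏ r ∈ range n, (1 + ∑ i : Fin (t + 1),
          MvPolynomial.C (Polynomial.C (a i) * Polynomial.X) *
            MvPolynomial.X (r + (i : ℕ))) ^ k) := by
  have h := sum_embedding_eq_fallingEval (fun i => Polynomial.C (a i) * Polynomial.X)
    (fun (r : Fin n × Fin k) (i : Fin (t + 1)) => (r.1 : ℕ) + i)
    (fun c => ((colSel n k t β α c).1 : ℕ))
  rw [card_colSel_eq, Fintype.prod_prod_type] at h
  simp only [prod_const, card_univ, Fintype.card_fin] at h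
  rw [prod_range, ← h, rookPolynomial]
  refine sum_congr rfl fun S _ => ?_
  rw [mul_sum]
  refine sum_congr rfl fun σ _ => ?_
  -- Each row of `S` receives one factor `X`, so the weights become `a_i X`.
  rw [map_prod, ← Fintype.card_coe S, ← card_univ, ← prod_const, ← prod_mul_distrib]
  refine prod_congr rfl fun r _ => ?_
  rw [bandSubmatrix_apply, map_sum, mul_sum]
  refine sum_congr rfl fun i _ => ?_
  rw [apply_ite Polynomial.C, map_zero, mul_ite, mul_zero, mul_comm]

theorem prod_choose_mul_rookPolynomial (a : Fin (t + 1) → A) (β : G k (min n t)) (α : G k t) :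
    (∏ i : Fin (min n t), (k.choose (β i : ℕ) : Polynomial A)) *
        rookPolynomial (bandSubmatrix n k t a β α) = weightedSum n k t a β α := by
  classical
  have hrem (i : Fin (min n t)) : removedMult β i = β i := dif_pos i.2
  have hfull (i : Fin (min n t)) : fullMult n α i = k :=
    if_pos (i.2.trans_le (Nat.min_le_left n t))
  have h1 := fallingEval_prod_choose (range (min n t)) (removedMult β)
    (fun j hj => dif_neg fun h => hj (mem_range.2 h)) (fullMult n α)
    (∏ r ∈ range n, (1 + ∑ i : Fin (t + 1),
      MvPolynomial.C (Polynomial.C (a i) * Polynomial.X) * MvPolynomial.X (r + (i : ℕ))) ^ k)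
  -- With the deletion moved into the weight, the first `n` classes are full, as the band formula
  -- requires.
  rw [fallingEval_band t _ _ (fun γ : G k t => ((∏ i : Fin (min n t),
      (γ (Fin.castLE (min_le_right n t) i) : ℕ).choose (β i : ℕ) : ℕ) : Polynomial A))
    (fun c γ hγ => ?_) n α (fullMult n α) (fun j hj => if_pos hj) (fun i => ?_),
    ← rookPolynomial_bandSubmatrix, prod_range] at h1
  · simp only [hrem, hfull, Nat.cast_prod] at h1
    rw [← h1, weightedSum, sum_filter_of_ne]
    · exact sum_congr rfl fun γ _ => mul_comm _ _
    · intro γ _ hγ i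
      by_contra hi
      refine hγ ?_
      rw [prod_eq_zero (mem_univ i) _, zero_mul]
      rw [Nat.choose_eq_zero_of_lt (not_le.1 hi), Nat.cast_zero]
  · rw [prod_range]
    congr 1
    refine prod_congr rfl fun i _ => ?_
    rw [hrem, ← hγ]
    rfl
  · simp [fullMult]

theorem rookPolynomial_map {A' R C : Type*} [CommRing A'] [Fintype R] [DecidableEq R] [Fintype C]
    [DecidableEq C] (φ : A →+* A') (M : Matrix R C A) :
    (rookPolynomial M).map φ = rookPolynomial (M.map φ) := by
  simp [rookPolynomial, Polynomial.map_sum, Polynomial.map_prod]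

theorem bandSubmatrix_map {A' : Type*} [CommRing A'] (φ : A →+* A') (a : Fin (t + 1) → A)
    (β : G k (min n t)) (α : G k t) :
    (bandSubmatrix n k t a β α).map φ = bandSubmatrix n k t (fun i => φ (a i)) β α := by
  ext r c
  rw [Matrix.map_apply, bandSubmatrix_apply, bandSubmatrix_apply, map_sum]
  exact sum_congr rfl fun i _ => by rw [apply_ite φ, map_zero]

end Main

end RookToeplitz

theorem theorem1 (n k t : ℕ) (hn : 1 ≤ n) (hk : 1 ≤ k)
    (β : RookToeplitz.G k (min n t)) (α : RookToeplitz.G k t) :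
    ∃ Q : Polynomial (MvPolynomial (Fin (t + 1)) ℤ),
      Q.map (MvPolynomial.map (Int.castRingHom ℚ)) =
        Polynomial.C (MvPolynomial.C (∏ i : Fin (min n t), (k.choose (β i : ℕ) : ℚ)⁻¹)) *
          RookToeplitz.weightedSum n k t
            (MvPolynomial.X : Fin (t + 1) → MvPolynomial (Fin (t + 1)) ℚ) β α ∧
      ∀ (A : Type*) [CommRing A] (a : Fin (t + 1) → A),
        RookToeplitz.rookPolynomial (RookToeplitz.bandSubmatrix n k t a β α) =
          Q.map (MvPolynomial.eval₂Hom (Int.castRingHom A) a) ∧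
        (∏ i : Fin (min n t), (k.choose (β i : ℕ) : Polynomial A)) *
            RookToeplitz.rookPolynomial (RookToeplitz.bandSubmatrix n k t a β α) =
          RookToeplitz.weightedSum n k t a β α := by
  -- The witness is the universal case over `ℤ`; every other ring is a specialization, and over `ℚ`
  -- the binomials are invertible because `β i ≤ k`.
  refine ⟨RookToeplitz.rookPolynomial (RookToeplitz.bandSubmatrix n k t MvPolynomial.X β α), ?_,
    fun A _ a => ⟨?_, RookToeplitz.prod_choose_mul_rookPolynomial a β α⟩⟩
  · rw [RookToeplitz.rookPolynomial_map, RookToeplitz.bandSubmatrix_map,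
      ← RookToeplitz.prod_choose_mul_rookPolynomial, ← mul_assoc]
    have hprod : (∏ i : Fin (min n t), (k.choose (β i : ℕ) : ℚ)⁻¹) *
        ∏ i : Fin (min n t), (k.choose (β i : ℕ) : ℚ) = 1 := by
      rw [← Finset.prod_mul_distrib]
      refine Finset.prod_eq_one fun i _ => inv_mul_cancel₀ ?_
      exact Nat.cast_ne_zero.2 (Nat.choose_pos (Nat.lt_succ_iff.1 (β i).2)).ne'
    have hcast : (∏ i : Fin (min n t),
        (k.choose (β i : ℕ) : Polynomial (MvPolynomial (Fin (t + 1)) ℚ))) =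
        Polynomial.C (MvPolynomial.C (∏ i : Fin (min n t), (k.choose (β i : ℕ) : ℚ))) := by
      simp [map_prod]
    rw [hcast, ← map_mul, ← map_mul, hprod, map_one, map_one, one_mul]
    simp only [MvPolynomial.map_X]
  · rw [RookToeplitz.rookPolynomial_map, RookToeplitz.bandSubmatrix_map]
    simp only [MvPolynomial.coe_eval₂Hom, MvPolynomial.eval₂_X]
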